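/- Let $\Bbbk$ be a field, let $(\mathcal C,\otimes,1)$ be a $\Bbbk$-linear monoidal category (with $\otimes$ bilinear on morphisms), essentially small and hom-finite (all $\mathcal C(x,y)$ are finite-dimensional). Let $d\in\mathcal C$, and suppose that $(\mathcal C,d)$ is a left Grothendieck–Verdier category with dualising functor $D_\ell$: that is, $D_\ell\colon\mathcal C^{\mathrm{op}}\to\mathcal C$ is an equivalence of categories and there are isomorphisms $\mathcal C(x\otimes y,d)\cong\mathcal C(x,D_\ell y)$ natural in $x,y\in\mathcal C$. Let $[\mathcal C,\mathrm{vect}]$ be the category of $\Bbbk$-linear functors from $\mathcal C$ to $\Bbbk$-vector spaces that are finite-dimensional at every object. Assume that for all $F,G\in[\mathcal C,\mathrm{vect}]$ and all $x\in\mathcal C$ the ($\Bbbk$-linear) coend $$(F*G)(x)=\int^{a,b\in\mathcal C}\mathcal C(a\otimes b,x)\otimes_{\Bbbk}F(a)\otimes_{\Bbbk}G(b)$$ is finite-dimensional, so that $[\mathcal C,\mathrm{vect}]$ is a monoidal category with Day convolution $*$ as tensor product and $\mathcal C(1,-)$ as unit. Then $[\mathcal C,\mathrm{vect}]$ is a right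 Grothendieck–Verdier category with dualising object $K:=\mathcal C(-,d)^*\in[\mathcal C,\mathrm{vect}]$ and dualising functor $$\mathfrak D_r\colon[\mathcal C,\mathrm{vect}]^{\mathrm{op}}\to[\mathcal C,\mathrm{vect}],\qquad F\mapsto F(D_\ell-)^*.$$ That is, $\mathfrak D_r$ is an equivalence of categories, and there are isomorphisms $$[\mathcal C,\mathrm{vect}](F*G,K)\cong[\mathcal C,\mathrm{vect}](G,\mathfrak D_rF)$$ natural in $F,G\in[\mathcal C,\mathrm{vect}]$. Here $(-)^*$ denotes the $\Bbbk$-linear dual of a vector space. -/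

import Mathlib

open CategoryTheory MonoidalCategory Opposite

universe u v w

set_option linter.unusedSectionVars false

noncomputable section

namespace DayGV

section Coend

variable {k : Type w} [Field k] {C : Type u} [Category.{v} C] [Preadditive C] [Linear k C]
  [MonoidalCategory C]

/-- The coproduct of the vector spaces `C(a ⊗ b, x) ⊗ F a ⊗ G b` over all pairs of objects. -/
abbrev DayPre (F G : C ⥤ ModuleCat.{max u v w} k) (x : C) : Type (max u v w) :=
  DirectSum (C × C) fun p =>
    TensorProduct k (p.1 ⊗ p.2 ⟶ x) (TensorProduct k (F.obj p.1) (G.obj p.2))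

open Classical in
/-- The element `h ⊗ s ⊗ t` in the summand of `(a, b)`. -/
def DayPre.of (F G : C ⥤ ModuleCat.{max u v w} k) (x : C) (a b : C) (h : a ⊗ b ⟶ x)
    (s : F.obj a) (t : G.obj b) : DayPre F G x :=
  DirectSum.lof k (C × C) (fun p : C × C =>
    TensorProduct k (p.1 ⊗ p.2 ⟶ x) (TensorProduct k (F.obj p.1) (G.obj p.2))) (a, b)
    (TensorProduct.tmul k h (TensorProduct.tmul k s t))

/-- The relations of the coend: the two actions of a morphism `(f, g)` of `C × C` are identified. -/
def dayRel (F G : C ⥤ ModuleCat.{max u v w} k) (x : C) : Submodule k (DayPre F G x) :=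
  Submodule.span k {z | ∃ (a a' b b' : C) (f : a ⟶ a') (g : b ⟶ b') (h : a' ⊗ b' ⟶ x)
    (s : F.obj a) (t : G.obj b),
    z = DayPre.of F G x a b ((f ⊗ₘ g) ≫ h) s t
      - DayPre.of F G x a' b' h (F.map f s) (G.map g t)}

/-- The value at `x` of the Day convolution of `F` and `G`, i.e. the coend
`∫^{a,b} C(a ⊗ b, x) ⊗ F a ⊗ G b`, as the coequaliser of its defining pair of maps. -/
abbrev DayObj (F G : C ⥤ ModuleCat.{max u v w} k) (x : C) : Type (max u v w) :=
  DayPre F G x ⧸ dayRel F G x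

variable {F G H K : C ⥤ ModuleCat.{max u v w} k} {x y : C}

/-- The class of `h ⊗ s ⊗ t` in the coend. -/
def dayMk {a b : C} (h : a ⊗ b ⟶ x) (s : F.obj a) (t : G.obj b) : DayObj F G x :=
  (dayRel F G x).mkQ (DayPre.of F G x a b h s t)

section
variable {a b : C}

lemma dayMk_add₁ (h h' : a ⊗ b ⟶ x) (s : F.obj a) (t : G.obj b) :
    dayMk (h + h') s t = dayMk h s t + dayMk h' s t := by
  simp [dayMk, DayPre.of, TensorProduct.add_tmul]

lemma dayMk_smul₁ (r : k) (h : a ⊗ b ⟶ x) (s : F.obj a) (t : G.obj b) :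
    dayMk (r • h) s t = r • dayMk h s t := by
  simp only [dayMk, DayPre.of, ← TensorProduct.smul_tmul', map_smul]

lemma dayMk_add₂ (h : a ⊗ b ⟶ x) (s s' : F.obj a) (t : G.obj b) :
    dayMk h (s + s') t = dayMk h s t + dayMk h s' t := by
  simp [dayMk, DayPre.of, TensorProduct.add_tmul, TensorProduct.tmul_add]

lemma dayMk_smul₂ (r : k) (h : a ⊗ b ⟶ x) (s : F.obj a) (t : G.obj b) :
    dayMk h (r • s) t = r • dayMk h s t := by
  simp only [dayMk, DayPre.of, ← TensorProduct.smul_tmul', TensorProduct.tmul_smul, map_smul]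

lemma dayMk_add₃ (h : a ⊗ b ⟶ x) (s : F.obj a) (t t' : G.obj b) :
    dayMk h s (t + t') = dayMk h s t + dayMk h s t' := by
  simp [dayMk, DayPre.of, TensorProduct.tmul_add]

lemma dayMk_smul₃ (r : k) (h : a ⊗ b ⟶ x) (s : F.obj a) (t : G.obj b) :
    dayMk h s (r • t) = r • dayMk h s t := by
  simp only [dayMk, DayPre.of, TensorProduct.tmul_smul, map_smul]

lemma dayMk_map {a' b' : C} (f : a ⟶ a') (g : b ⟶ b') (h : a' ⊗ b' ⟶ x)
    (s : F.obj a) (t : G.obj b) :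
    dayMk h (F.map f s) (G.map g t) = dayMk ((f ⊗ₘ g) ≫ h) s t := by
  symm
  rw [← sub_eq_zero]
  simp only [dayMk]
  rw [← map_sub, Submodule.mkQ_apply, Submodule.Quotient.mk_eq_zero]
  exact Submodule.subset_span ⟨a, a', b, b', f, g, h, s, t, rfl⟩

lemma dayMk_map_left {a' : C} (f : a ⟶ a') (h : a' ⊗ b ⟶ x) (s : F.obj a) (t : G.obj b) :
    dayMk h (F.map f s) t = dayMk (f ▷ b ≫ h) s t := by
  have := dayMk_map f (𝟙 b) h s t
  simpa using this

lemma dayMk_map_right {b' : C} (g : b ⟶ b') (h : a ⊗ b' ⟶ x) (s : F.obj a) (t : G.obj b) :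
    dayMk h s (G.map g t) = dayMk (a ◁ g ≫ h) s t := by
  have := dayMk_map (𝟙 a) g h s t
  simpa using this

end

lemma day_linearMap_ext {M : Type*} [AddCommGroup M] [Module k M] {p q : DayObj F G x →ₗ[k] M}
    (hpq : ∀ (a b : C) (h : a ⊗ b ⟶ x) (s : F.obj a) (t : G.obj b),
      p (dayMk h s t) = q (dayMk h s t)) : p = q := by
  classical
  apply Submodule.linearMap_qext
  refine DirectSum.linearMap_ext k fun ⟨a, b⟩ => ?_
  refine TensorProduct.ext' fun h z => ?_
  induction z using TensorProduct.induction_on with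
  | zero => simp
  | tmul s t =>
    have := hpq a b h s t
    simp only [dayMk, DayPre.of] at this
    convert this <;> rfl
  | add z z' hz hz' => rw [TensorProduct.tmul_add, map_add, map_add, hz, hz']

open Classical in
/-- The universal property of the coend. -/
def dayLift {M : Type*} [AddCommGroup M] [Module k M]
    (φ : ∀ a b : C, (a ⊗ b ⟶ x) →ₗ[k] F.obj a →ₗ[k] G.obj b →ₗ[k] M)
    (hφ : ∀ (a a' b b' : C) (f : a ⟶ a') (g : b ⟶ b') (h : a' ⊗ b' ⟶ x)
      (s : F.obj a) (t : G.obj b),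
      φ a b ((f ⊗ₘ g) ≫ h) s t = φ a' b' h (F.map f s) (G.map g t)) : DayObj F G x →ₗ[k] M :=
  (dayRel F G x).liftQ
    (DirectSum.toModule k (C × C) M fun p =>
      TensorProduct.lift ((TensorProduct.lift.equiv (.id k) _ _ M).toLinearMap ∘ₗ φ p.1 p.2)) (by
    rw [dayRel, Submodule.span_le]
    rintro _ ⟨a, a', b, b', f, g, h, s, t, rfl⟩
    simp [DayPre.of, DirectSum.toModule_lof, hφ])

@[simp] lemma dayLift_mk {M : Type*} [AddCommGroup M] [Module k M]
    (φ : ∀ a b : C, (a ⊗ b ⟶ x) →ₗ[k] F.obj a →ₗ[k] G.obj b →ₗ[k] M) (hφ)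
    {a b : C} (h : a ⊗ b ⟶ x) (s : F.obj a) (t : G.obj b) :
    dayLift φ hφ (dayMk h s t) = φ a b h s t := by
  classical
  simp [dayLift, dayMk, DayPre.of, DirectSum.toModule_lof]

/-- `dayMk` as a trilinear map. -/
def dayMkₗ (F G : C ⥤ ModuleCat.{max u v w} k) (x a b : C) :
    (a ⊗ b ⟶ x) →ₗ[k] F.obj a →ₗ[k] G.obj b →ₗ[k] DayObj F G x :=
  LinearMap.mk₂ k (fun h s =>
    { toFun := fun t => dayMk h s t
      map_add' := dayMk_add₃ h s
      map_smul' := fun r t => dayMk_smul₃ r h s t })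
    (fun h h' s => by ext t; exact dayMk_add₁ h h' s t)
    (fun r h s => by ext t; exact dayMk_smul₁ r h s t)
    (fun h s s' => by ext t; exact dayMk_add₂ h s s' t)
    (fun r h s => by ext t; exact dayMk_smul₂ r h s t)

@[simp] lemma dayMkₗ_apply {a b : C} (h : a ⊗ b ⟶ x) (s : F.obj a) (t : G.obj b) :
    dayMkₗ F G x a b h s t = dayMk h s t := rfl

end Coend

section Functors

variable (k : Type w) [Field k] (C : Type u) [Category.{v} C] [Preadditive C] [Linear k C]

/-- The property of being a `k`-linear functor to vector spaces. -/
def isLinear : ObjectProperty (C ⥤ ModuleCat.{max u v w} k) :=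
  fun F => F.Additive ∧ F.Linear k

/-- The category `[C, Vect]` of `k`-linear functors from `C` to `k`-vector spaces. -/
abbrev LinFun := (isLinear k C).FullSubcategory

variable {k C}

instance (F : LinFun k C) : F.obj.Additive := F.property.1

instance (F : LinFun k C) : F.obj.Linear k := F.property.2

/-- The vector space `F x`. -/
abbrev LinFun.at (F : LinFun k C) (x : C) : ModuleCat.{max u v w} k := F.obj.obj x

lemma LinFun.hom_ext {F G : LinFun k C} {σ τ : F ⟶ G}
    (h : ∀ (x : C) (s : F.at x), σ.hom.app x s = τ.hom.app x s) : σ = τ := by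
  apply ObjectProperty.hom_ext
  ext x s
  exact h x s

lemma LinFun.map_add_apply (F : LinFun k C) {x y : C} (f g : x ⟶ y) (s : F.at x) :
    F.obj.map (f + g) s = F.obj.map f s + F.obj.map g s := by
  rw [F.obj.map_add]; rfl

lemma LinFun.map_smul_apply (F : LinFun k C) {x y : C} (r : k) (f : x ⟶ y) (s : F.at x) :
    F.obj.map (r • f) s = r • F.obj.map f s := by
  rw [F.obj.map_smul]; rfl

lemma LinFun.map_comp_apply (F : LinFun k C) {x y z : C} (f : x ⟶ y) (g : y ⟶ z) (s : F.at x) :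
    F.obj.map (f ≫ g) s = F.obj.map g (F.obj.map f s) := by
  rw [F.obj.map_comp]; rfl

lemma LinFun.map_id_apply (F : LinFun k C) {x : C} (s : F.at x) :
    F.obj.map (𝟙 x) s = s := by
  rw [F.obj.map_id]; rfl

lemma LinFun.naturality_apply {F G : LinFun k C} (τ : F ⟶ G) {x y : C} (f : x ⟶ y)
    (s : F.at x) : τ.hom.app y (F.obj.map f s) = G.obj.map f (τ.hom.app x s) :=
  NatTrans.naturality_apply τ.hom f s

lemma LinFun.comp_apply {F G H : LinFun k C} (σ : F ⟶ G) (τ : G ⟶ H) {x : C} (s : F.at x) :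
    (σ ≫ τ).hom.app x s = τ.hom.app x (σ.hom.app x s) := rfl

lemma LinFun.id_apply {F : LinFun k C} {x : C} (s : F.at x) :
    (InducedCategory.Hom.hom (𝟙 F)).app x s = s := rfl

end Functors

section Day

variable {k : Type w} [Field k] {C : Type u} [Category.{v} C] [Preadditive C] [Linear k C]
  [MonoidalCategory C]

/-- The action of a morphism `x ⟶ y` on the coends. -/
def dayObjMap (F G : C ⥤ ModuleCat.{max u v w} k) {x y : C} (f : x ⟶ y) :
    DayObj F G x →ₗ[k] DayObj F G y :=
  dayLift (fun a b => (dayMkₗ F G y a b) ∘ₗ (Linear.rightComp k (a ⊗ b) f))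
    (fun a a' b b' f' g' h s t => by simp [dayMk_map])

@[simp] lemma dayObjMap_mk {F G : C ⥤ ModuleCat.{max u v w} k} {a b x y : C} (f : x ⟶ y)
    (h : a ⊗ b ⟶ x) (s : F.obj a) (t : G.obj b) :
    dayObjMap F G f (dayMk h s t) = dayMk (h ≫ f) s t := by
  simp [dayObjMap]

/-- The Day convolution `F * G = ∫^{a,b} C(a ⊗ b, -) ⊗ F a ⊗ G b` of two linear functors. -/
def dayConv (F G : LinFun k C) : LinFun k C where
  obj :=
    { obj := fun x => ModuleCat.of k (DayObj F.obj G.obj x)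
      map := fun {x y} f => ModuleCat.ofHom (dayObjMap F.obj G.obj f)
      map_id := fun x => by
        ext1
        exact day_linearMap_ext fun a b h s t => by simp
      map_comp := fun f g => by
        ext1
        exact day_linearMap_ext fun a b h s t => by simp }
  property :=
    ⟨⟨fun {x y f g} => by
        ext1
        exact day_linearMap_ext fun a b h s t => by simp [dayMk_add₁]⟩,
      ⟨fun {x y} f r => by
        ext1
        exact day_linearMap_ext fun a b h s t => by simp [dayMk_smul₁]⟩⟩

/-- The unit `C(1, -)` of Day convolution. -/
def dayUnit (k : Type w) [Field k] (C : Type u) [Category.{v} C] [Preadditive C] [Linear k C]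
    [MonoidalCategory C] : LinFun k C where
  obj :=
    { obj := fun x => ModuleCat.of k (ULift.{max u w} (𝟙_ C ⟶ x))
      map := fun {x y} f => ModuleCat.ofHom
        (ULift.moduleEquiv.symm.toLinearMap ∘ₗ Linear.rightComp k (𝟙_ C) f ∘ₗ
          ULift.moduleEquiv.toLinearMap) }
  property :=
    ⟨⟨fun {x y f g} => by ext ⟨s⟩; simp⟩, ⟨fun {x y} f r => by ext ⟨s⟩; simp⟩⟩

variable {F G H K L : LinFun k C}

/-- The class of `h ⊗ s ⊗ t` as an element of `(F * G) x`. -/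
def mk {F G : LinFun k C} {a b x : C} (h : a ⊗ b ⟶ x) (s : F.at a) (t : G.at b) :
    (dayConv F G).at x :=
  (dayMk h s t : DayObj F.obj G.obj x)

lemma dayConv_map {a b x y : C} (f : x ⟶ y) (h : a ⊗ b ⟶ x) (s : F.at a) (t : G.at b) :
    (dayConv F G).obj.map f (mk h s t) = mk (h ≫ f) s t :=
  dayObjMap_mk f h s t

lemma dayMk_eq_map {a b x : C} (h : a ⊗ b ⟶ x) (s : F.at a) (t : G.at b) :
    mk h s t = (dayConv F G).obj.map h (mk (𝟙 (a ⊗ b)) s t) := by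
  rw [dayConv_map, Category.id_comp]

lemma dayUnit_map {x y : C} (f : x ⟶ y) (s : 𝟙_ C ⟶ x) :
    (dayUnit k C).obj.map f (ULift.up s) = ULift.up (s ≫ f) := rfl

/-- The components of a morphism out of a Day convolution, from a family of bilinear maps
`F a × G b → H (a ⊗ b)` natural in `a` and `b`. -/
def dayDescApp (φ : ∀ a b : C, F.at a →ₗ[k] G.at b →ₗ[k] H.at (a ⊗ b))
    (hφ : ∀ (a a' b b' : C) (f : a ⟶ a') (g : b ⟶ b') (s : F.at a) (t : G.at b),
      φ a' b' (F.obj.map f s) (G.obj.map g t) = H.obj.map (f ⊗ₘ g) (φ a b s t)) (x : C) :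
    DayObj F.obj G.obj x →ₗ[k] H.at x :=
  dayLift (fun a b => LinearMap.mk₂ k (fun h s => (H.obj.map h).hom ∘ₗ φ a b s)
    (fun h h' s => by ext t; exact H.map_add_apply h h' (φ a b s t))
    (fun r h s => by ext t; exact H.map_smul_apply r h (φ a b s t))
    (fun h s s' => by ext t; simp)
    (fun r h s => by ext t; simp))
    (fun a a' b b' f g h s t =>
      (H.map_comp_apply (f ⊗ₘ g) h (φ a b s t)).trans
        (congrArg (H.obj.map h) (hφ a a' b b' f g s t).symm))

@[simp] lemma dayDescApp_mk (φ : ∀ a b : C, F.at a →ₗ[k] G.at b →ₗ[k] H.at (a ⊗ b)) (hφ)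
    {a b x : C} (h : a ⊗ b ⟶ x) (s : F.at a) (t : G.at b) :
    dayDescApp φ hφ x (dayMk h s t) = H.obj.map h (φ a b s t) :=
  dayLift_mk _ _ h s t

/-- The morphism out of a Day convolution induced by a natural family of bilinear maps. -/
def dayDesc (φ : ∀ a b : C, F.at a →ₗ[k] G.at b →ₗ[k] H.at (a ⊗ b))
    (hφ : ∀ (a a' b b' : C) (f : a ⟶ a') (g : b ⟶ b') (s : F.at a) (t : G.at b),
      φ a' b' (F.obj.map f s) (G.obj.map g t) = H.obj.map (f ⊗ₘ g) (φ a b s t)) :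
    dayConv F G ⟶ H :=
  ObjectProperty.homMk
    { app := fun x => ModuleCat.ofHom (dayDescApp φ hφ x)
      naturality := fun x y f => by
        ext1
        refine day_linearMap_ext fun a b h s t => ?_
        refine (congrArg (dayDescApp φ hφ y) (dayConv_map f h s t)).trans ?_
        refine (dayDescApp_mk φ hφ (h ≫ f) s t).trans ?_
        rw [LinFun.map_comp_apply]
        exact congrArg (H.obj.map f) (dayDescApp_mk φ hφ h s t).symm }

lemma dayDesc_mk (φ : ∀ a b : C, F.at a →ₗ[k] G.at b →ₗ[k] H.at (a ⊗ b)) (hφ) {a b x : C}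
    (h : a ⊗ b ⟶ x) (s : F.at a) (t : G.at b) :
    (dayDesc φ hφ).hom.app x (mk h s t) = H.obj.map h (φ a b s t) :=
  dayDescApp_mk φ hφ h s t

lemma dayConv_linear_ext {x : C} {M : Type*} [AddCommGroup M] [Module k M]
    {p q : (dayConv F G).at x →ₗ[k] M}
    (hpq : ∀ (a b : C) (h : a ⊗ b ⟶ x) (s : F.at a) (t : G.at b),
      p (mk h s t) = q (mk h s t)) : p = q :=
  day_linearMap_ext hpq

lemma dayConv_hom_ext {σ τ : dayConv F G ⟶ H}
    (hστ : ∀ (a b : C) (s : F.at a) (t : G.at b),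
      σ.hom.app _ (mk (𝟙 (a ⊗ b)) s t) = τ.hom.app _ (mk (𝟙 (a ⊗ b)) s t)) : σ = τ := by
  apply ObjectProperty.hom_ext
  ext x : 2
  ext1
  refine dayConv_linear_ext fun a b h s t => ?_
  rw [dayMk_eq_map]
  exact (LinFun.naturality_apply σ _ _).trans ((congrArg _ (hστ a b s t)).trans
    (LinFun.naturality_apply τ _ _).symm)

end Day

section Monoidal

variable {k : Type w} [Field k] {C : Type u} [Category.{v} C] [Preadditive C] [Linear k C]
  [MonoidalCategory C]

section

variable {F G H K L F' G' H' : LinFun k C}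

/-- `mk h` as a bilinear map. -/
def mkₗ (F G : LinFun k C) {a b x : C} (h : a ⊗ b ⟶ x) :
    F.at a →ₗ[k] G.at b →ₗ[k] (dayConv F G).at x :=
  dayMkₗ F.obj G.obj x a b h

@[simp] lemma mkₗ_apply {a b x : C} (h : a ⊗ b ⟶ x) (s : F.at a) (t : G.at b) :
    mkₗ F G h s t = mk h s t := rfl

lemma mk_add₁ {a b x : C} (h h' : a ⊗ b ⟶ x) (s : F.at a) (t : G.at b) :
    mk (h + h') s t = mk h s t + mk h' s t := dayMk_add₁ h h' s t

lemma mk_smul₁ {a b x : C} (r : k) (h : a ⊗ b ⟶ x) (s : F.at a) (t : G.at b) :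
    mk (r • h) s t = r • mk h s t := dayMk_smul₁ r h s t

lemma mk_map {a b a' b' x : C} (f : a ⟶ a') (g : b ⟶ b') (h : a' ⊗ b' ⟶ x)
    (s : F.at a) (t : G.at b) :
    mk h (F.obj.map f s) (G.obj.map g t) = mk ((f ⊗ₘ g) ≫ h) s t := dayMk_map f g h s t

lemma mk_map_left {a a' b x : C} (f : a ⟶ a') (h : a' ⊗ b ⟶ x) (s : F.at a) (t : G.at b) :
    mk h (F.obj.map f s) t = mk (f ▷ b ≫ h) s t := dayMk_map_left f h s t

lemma mk_map_right {a b b' x : C} (g : b ⟶ b') (h : a ⊗ b' ⟶ x) (s : F.at a) (t : G.at b) :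
    mk h s (G.obj.map g t) = mk (a ◁ g ≫ h) s t := dayMk_map_right g h s t

/-- Move the morphism of an inner class outwards. -/
lemma mk_mk_left {a b c x y : C} (h : x ⊗ c ⟶ y) (f : a ⊗ b ⟶ x) (s : F.at a) (t : G.at b)
    (z : H.at c) : mk h (mk f s t) z = mk (f ▷ c ≫ h) (mk (𝟙 (a ⊗ b)) s t) z := by
  rw [dayMk_eq_map f, mk_map_left]

lemma mk_mk_right {a b c x y : C} (h : a ⊗ x ⟶ y) (f : b ⊗ c ⟶ x) (s : F.at a) (t : G.at b)
    (z : H.at c) : mk h s (mk f t z) = mk (a ◁ f ≫ h) s (mk (𝟙 (b ⊗ c)) t z) := by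
  rw [dayMk_eq_map f, mk_map_right]

/-- The Day convolution of two morphisms. -/
def dayHom (σ : F ⟶ F') (τ : G ⟶ G') : dayConv F G ⟶ dayConv F' G' :=
  dayDesc (fun a b => (mkₗ F' G' (𝟙 (a ⊗ b))).compl₁₂ (σ.hom.app a).hom (τ.hom.app b).hom)
    (fun a a' b b' f g s t => by
      change mk _ (σ.hom.app a' (F.obj.map f s)) (τ.hom.app b' (G.obj.map g t)) =
        (dayConv F' G').obj.map _ (mk (𝟙 (a ⊗ b)) (σ.hom.app a s) (τ.hom.app b t))
      rw [LinFun.naturality_apply, LinFun.naturality_apply, mk_map, dayConv_map]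
      simp)

lemma dayHom_mk (σ : F ⟶ F') (τ : G ⟶ G') {a b x : C} (h : a ⊗ b ⟶ x) (s : F.at a)
    (t : G.at b) :
    (dayHom σ τ).hom.app x (mk h s t) = mk h (σ.hom.app a s) (τ.hom.app b t) := by
  refine (dayDesc_mk _ _ h s t).trans ?_
  exact (dayMk_eq_map h _ _).symm

lemma dayConv_hom_ext_left {σ τ : dayConv (dayConv F G) H ⟶ K}
    (hστ : ∀ (a b c : C) (s : F.at a) (t : G.at b) (z : H.at c),
      σ.hom.app _ (mk (𝟙 ((a ⊗ b) ⊗ c)) (mk (𝟙 (a ⊗ b)) s t) z) =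
        τ.hom.app _ (mk (𝟙 ((a ⊗ b) ⊗ c)) (mk (𝟙 (a ⊗ b)) s t) z)) : σ = τ := by
  refine dayConv_hom_ext fun x c p z => ?_
  have key : (σ.hom.app _).hom ∘ₗ (mkₗ (dayConv F G) H (𝟙 (x ⊗ c))).flip z =
      (τ.hom.app _).hom ∘ₗ (mkₗ (dayConv F G) H (𝟙 (x ⊗ c))).flip z := by
    refine dayConv_linear_ext fun a b h s t => ?_
    change σ.hom.app _ (mk (𝟙 (x ⊗ c)) (mk h s t) z) = τ.hom.app _ (mk (𝟙 (x ⊗ c)) (mk h s t) z)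
    rw [mk_mk_left, dayMk_eq_map, LinFun.naturality_apply, LinFun.naturality_apply, hστ]
  exact LinearMap.congr_fun key p

lemma dayConv_hom_ext_right {σ τ : dayConv F (dayConv G H) ⟶ K}
    (hστ : ∀ (a b c : C) (s : F.at a) (t : G.at b) (z : H.at c),
      σ.hom.app _ (mk (𝟙 (a ⊗ (b ⊗ c))) s (mk (𝟙 (b ⊗ c)) t z)) =
        τ.hom.app _ (mk (𝟙 (a ⊗ (b ⊗ c))) s (mk (𝟙 (b ⊗ c)) t z))) : σ = τ := by
  refine dayConv_hom_ext fun a x s p => ?_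
  have key : (σ.hom.app _).hom ∘ₗ (mkₗ F (dayConv G H) (𝟙 (a ⊗ x))) s =
      (τ.hom.app _).hom ∘ₗ (mkₗ F (dayConv G H) (𝟙 (a ⊗ x))) s := by
    refine dayConv_linear_ext fun b c h t z => ?_
    change σ.hom.app _ (mk (𝟙 (a ⊗ x)) s (mk h t z)) = τ.hom.app _ (mk (𝟙 (a ⊗ x)) s (mk h t z))
    rw [mk_mk_right, dayMk_eq_map, LinFun.naturality_apply, LinFun.naturality_apply, hστ]
  exact LinearMap.congr_fun key p

lemma dayConv_hom_ext_left₂ {σ τ : dayConv (dayConv (dayConv F G) H) K ⟶ L}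
    (hστ : ∀ (a b c d : C) (s : F.at a) (t : G.at b) (z : H.at c) (w : K.at d),
      σ.hom.app _ (mk (𝟙 (((a ⊗ b) ⊗ c) ⊗ d))
          (mk (𝟙 ((a ⊗ b) ⊗ c)) (mk (𝟙 (a ⊗ b)) s t) z) w) =
        τ.hom.app _ (mk (𝟙 (((a ⊗ b) ⊗ c) ⊗ d))
          (mk (𝟙 ((a ⊗ b) ⊗ c)) (mk (𝟙 (a ⊗ b)) s t) z) w)) : σ = τ := by
  refine dayConv_hom_ext_left fun x c d p z w => ?_
  have key : (σ.hom.app _).hom ∘ₗ (mkₗ (dayConv (dayConv F G) H) K (𝟙 ((x ⊗ c) ⊗ d))).flip w ∘ₗ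
        (mkₗ (dayConv F G) H (𝟙 (x ⊗ c))).flip z =
      (τ.hom.app _).hom ∘ₗ (mkₗ (dayConv (dayConv F G) H) K (𝟙 ((x ⊗ c) ⊗ d))).flip w ∘ₗ
        (mkₗ (dayConv F G) H (𝟙 (x ⊗ c))).flip z := by
    refine dayConv_linear_ext fun a b h s t => ?_
    change σ.hom.app _ (mk (𝟙 _) (mk (𝟙 (x ⊗ c)) (mk h s t) z) w) =
      τ.hom.app _ (mk (𝟙 _) (mk (𝟙 (x ⊗ c)) (mk h s t) z) w)
    rw [mk_mk_left _ h, mk_mk_left, dayMk_eq_map, LinFun.naturality_apply,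
      LinFun.naturality_apply, hστ]
  exact LinearMap.congr_fun key p

/-- A morphism `1 ⟶ x` as an element of `C(1, x)`. -/
def unitMk {x : C} (t : 𝟙_ C ⟶ x) : (dayUnit k C).at x := ULift.up t

/-- An element of `C(1, x)` as a morphism `1 ⟶ x`. -/
def unitDn {x : C} (t : (dayUnit k C).at x) : 𝟙_ C ⟶ x := ULift.down t

lemma unitMk_unitDn {x : C} (t : (dayUnit k C).at x) : unitMk (unitDn t) = t := rfl

@[simp] lemma unitDn_unitMk {x : C} (t : 𝟙_ C ⟶ x) : unitDn (unitMk t : (dayUnit k C).at x) = t :=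
  rfl

lemma unitDn_add {x : C} (t t' : (dayUnit k C).at x) :
    unitDn (t + t') = unitDn t + unitDn t' := rfl

lemma unitDn_smul {x : C} (r : k) (t : (dayUnit k C).at x) :
    unitDn (r • t) = r • unitDn t := rfl

lemma unit_map {x y : C} (f : x ⟶ y) (t : (dayUnit k C).at x) :
    (dayUnit k C).obj.map f t = unitMk (unitDn t ≫ f) := rfl

lemma dayUnit_eq_map {x : C} (t : (dayUnit k C).at x) :
    t = (dayUnit k C).obj.map (unitDn t) (unitMk (𝟙 (𝟙_ C))) := by
  rw [unit_map, unitDn_unitMk, Category.id_comp, unitMk_unitDn]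

variable [MonoidalPreadditive C] [MonoidalLinear k C]

/-- The bilinear maps `(F * G) x × H c → (F * (G * H)) (x ⊗ c)` defining the associator. -/
def assocFam (F G H : LinFun k C) (x c : C) :
    (dayConv F G).at x →ₗ[k] H.at c →ₗ[k] (dayConv F (dayConv G H)).at (x ⊗ c) :=
  dayLift (fun a b => LinearMap.mk₂ k
      (fun h s => (mkₗ G H (𝟙 (b ⊗ c))).compr₂ (mkₗ F (dayConv G H) ((α_ a b c).inv ≫ h ▷ c) s))
      (fun h h' s => by
        ext t z
        change mk ((α_ a b c).inv ≫ (h + h') ▷ c) s (mk (𝟙 (b ⊗ c)) t z) =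
          mk ((α_ a b c).inv ≫ h ▷ c) s (mk (𝟙 (b ⊗ c)) t z) +
            mk ((α_ a b c).inv ≫ h' ▷ c) s (mk (𝟙 (b ⊗ c)) t z)
        rw [MonoidalPreadditive.add_whiskerRight, Preadditive.comp_add, mk_add₁])
      (fun r h s => by
        ext t z
        change mk ((α_ a b c).inv ≫ (r • h) ▷ c) s (mk (𝟙 (b ⊗ c)) t z) =
          r • mk ((α_ a b c).inv ≫ h ▷ c) s (mk (𝟙 (b ⊗ c)) t z)
        rw [MonoidalLinear.smul_whiskerRight, Linear.comp_smul, mk_smul₁])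
      (fun h s s' => by ext t z; simp)
      (fun r h s => by ext t z; simp))
    (fun a a' b b' f g h s t => by
      ext z
      change mk ((α_ a b c).inv ≫ ((f ⊗ₘ g) ≫ h) ▷ c) s (mk (𝟙 _) t z) =
        mk ((α_ a' b' c).inv ≫ h ▷ c) (F.obj.map f s) (mk (𝟙 _) (G.obj.map g t) z)
      rw [mk_map_left g, mk_map_left f, mk_mk_right _ (g ▷ c ≫ 𝟙 _)]
      congr 1
      simp [MonoidalCategory.tensorHom_def'])

lemma assocFam_mk {a b c x : C} (h : a ⊗ b ⟶ x) (s : F.at a) (t : G.at b) (z : H.at c) :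
    assocFam F G H x c (mk h s t) z =
      mk ((α_ a b c).inv ≫ h ▷ c) s (mk (𝟙 (b ⊗ c)) t z) :=
  LinearMap.congr_fun (dayLift_mk _ _ h s t) z

/-- The associator `(F * G) * H ⟶ F * (G * H)`. -/
def assocHom (F G H : LinFun k C) :
    dayConv (dayConv F G) H ⟶ dayConv F (dayConv G H) :=
  dayDesc (assocFam F G H) (fun x x' c c' f g p z => by
    have key : (assocFam F G H x' c').compl₁₂ ((dayConv F G).obj.map f).hom (H.obj.map g).hom =
        (assocFam F G H x c).compr₂ ((dayConv F (dayConv G H)).obj.map (f ⊗ₘ g)).hom := by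
      refine dayConv_linear_ext fun a b h s t => ?_
      ext z
      change assocFam F G H x' c' ((dayConv F G).obj.map f (mk h s t)) (H.obj.map g z) =
        (dayConv F (dayConv G H)).obj.map (f ⊗ₘ g) (assocFam F G H x c (mk h s t) z)
      rw [dayConv_map, assocFam_mk, assocFam_mk, dayConv_map, mk_map_right, mk_mk_right]
      congr 1
      simp only [MonoidalCategory.tensorHom_def', comp_whiskerRight, Category.assoc]
      rw [← whisker_exchange_assoc]
      simp
    exact LinearMap.congr_fun (LinearMap.congr_fun key p) z)

lemma assocHom_mk {a b c : C} (s : F.at a) (t : G.at b) (z : H.at c) {x y : C}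
    (f : a ⊗ b ⟶ x) (h : x ⊗ c ⟶ y) :
    (assocHom F G H).hom.app y (mk h (mk f s t) z) =
      mk ((α_ a b c).inv ≫ f ▷ c ≫ h) s (mk (𝟙 (b ⊗ c)) t z) := by
  refine (dayDesc_mk _ _ h (mk f s t) z).trans ?_
  rw [assocFam_mk, dayConv_map]
  simp

/-- The bilinear maps `F a × (G * H) y → ((F * G) * H) (a ⊗ y)` defining the inverse associator. -/
def assocInvFam (F G H : LinFun k C) (a y : C) :
    (dayConv G H).at y →ₗ[k] F.at a →ₗ[k] (dayConv (dayConv F G) H).at (a ⊗ y) :=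
  dayLift (fun b c => LinearMap.mk₂ k
      (fun h t => (mkₗ (dayConv F G) H ((α_ a b c).hom ≫ a ◁ h) ∘ₗ
        (mkₗ F G (𝟙 (a ⊗ b))).flip t).flip)
      (fun h h' t => by
        ext z s
        change mk ((α_ a b c).hom ≫ a ◁ (h + h')) (mk (𝟙 (a ⊗ b)) s t) z =
          mk ((α_ a b c).hom ≫ a ◁ h) (mk (𝟙 (a ⊗ b)) s t) z +
            mk ((α_ a b c).hom ≫ a ◁ h') (mk (𝟙 (a ⊗ b)) s t) z
        rw [MonoidalPreadditive.whiskerLeft_add, Preadditive.comp_add, mk_add₁])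
      (fun r h t => by
        ext z s
        change mk ((α_ a b c).hom ≫ a ◁ (r • h)) (mk (𝟙 (a ⊗ b)) s t) z =
          r • mk ((α_ a b c).hom ≫ a ◁ h) (mk (𝟙 (a ⊗ b)) s t) z
        rw [MonoidalLinear.whiskerLeft_smul, Linear.comp_smul, mk_smul₁])
      (fun h t t' => by ext z s; simp)
      (fun r h t => by ext z s; simp))
    (fun b b' c c' f g h t z => by
      ext s
      change mk ((α_ a b c).hom ≫ a ◁ ((f ⊗ₘ g) ≫ h)) (mk (𝟙 _) s t) z =
        mk ((α_ a b' c').hom ≫ a ◁ h) (mk (𝟙 _) s (G.obj.map f t)) (H.obj.map g z)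
      rw [mk_map_right f, mk_map_right g, mk_mk_left _ (a ◁ f ≫ 𝟙 _)]
      congr 1
      simp [MonoidalCategory.tensorHom_def])

lemma assocInvFam_mk {a b c y : C} (h : b ⊗ c ⟶ y) (s : F.at a) (t : G.at b) (z : H.at c) :
    assocInvFam F G H a y (mk h t z) s =
      mk ((α_ a b c).hom ≫ a ◁ h) (mk (𝟙 (a ⊗ b)) s t) z :=
  LinearMap.congr_fun (dayLift_mk _ _ h t z) s

/-- The inverse associator `F * (G * H) ⟶ (F * G) * H`. -/
def assocInv (F G H : LinFun k C) :
    dayConv F (dayConv G H) ⟶ dayConv (dayConv F G) H :=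
  dayDesc (fun a y => (assocInvFam F G H a y).flip) (fun a a' y y' f g s p => by
    have key : (assocInvFam F G H a' y').compl₁₂ ((dayConv G H).obj.map g).hom (F.obj.map f).hom =
        (assocInvFam F G H a y).compr₂ ((dayConv (dayConv F G) H).obj.map (f ⊗ₘ g)).hom := by
      refine dayConv_linear_ext fun b c h t z => ?_
      ext s
      change assocInvFam F G H a' y' ((dayConv G H).obj.map g (mk h t z)) (F.obj.map f s) =
        (dayConv (dayConv F G) H).obj.map (f ⊗ₘ g) (assocInvFam F G H a y (mk h t z) s)
      rw [dayConv_map, assocInvFam_mk, assocInvFam_mk, dayConv_map, mk_map_left, mk_mk_left]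
      congr 1
      simp only [MonoidalCategory.tensorHom_def, MonoidalCategory.whiskerLeft_comp, Category.assoc]
      rw [whisker_exchange_assoc]
      simp
    exact LinearMap.congr_fun (LinearMap.congr_fun key p) s)

lemma assocInv_mk {a b c : C} (s : F.at a) (t : G.at b) (z : H.at c) {x y : C}
    (f : b ⊗ c ⟶ x) (h : a ⊗ x ⟶ y) :
    (assocInv F G H).hom.app y (mk h s (mk f t z)) =
      mk ((α_ a b c).hom ≫ a ◁ f ≫ h) (mk (𝟙 (a ⊗ b)) s t) z := by
  refine (dayDesc_mk _ _ h s (mk f t z)).trans ?_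
  change (dayConv (dayConv F G) H).obj.map h (assocInvFam F G H a x (mk f t z) s) = _
  rw [assocInvFam_mk, dayConv_map]
  simp

lemma assocHom_assocInv : assocHom F G H ≫ assocInv F G H = 𝟙 _ :=
  dayConv_hom_ext_left fun a b c s t z => by
    rw [LinFun.comp_apply, LinFun.id_apply, assocHom_mk, assocInv_mk]
    simp

lemma assocInv_assocHom : assocInv F G H ≫ assocHom F G H = 𝟙 _ :=
  dayConv_hom_ext_right fun a b c s t z => by
    rw [LinFun.comp_apply, LinFun.id_apply, assocInv_mk, assocHom_mk]
    simp

/-- The bilinear maps `C(1, a) × F b → F (a ⊗ b)` defining the left unitor. -/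
def leftUnitFam (F : LinFun k C) (a b : C) :
    (dayUnit k C).at a →ₗ[k] F.at b →ₗ[k] F.at (a ⊗ b) :=
  LinearMap.mk₂ k (fun t s => F.obj.map ((λ_ b).inv ≫ unitDn t ▷ b) s)
    (fun t t' s => by
      rw [unitDn_add, MonoidalPreadditive.add_whiskerRight, Preadditive.comp_add,
        LinFun.map_add_apply])
    (fun r t s => by
      rw [unitDn_smul, MonoidalLinear.smul_whiskerRight, Linear.comp_smul,
        LinFun.map_smul_apply])
    (fun t s s' => map_add _ _ _)
    (fun r t s => map_smul _ _ _)

/-- The left unitor `C(1, -) * F ⟶ F`. -/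
def leftUnitHom (F : LinFun k C) : dayConv (dayUnit k C) F ⟶ F :=
  dayDesc (leftUnitFam F) (fun a a' b b' f g t s => by
    change F.obj.map ((λ_ b').inv ≫ (unitDn t ≫ f) ▷ b') (F.obj.map g s) =
      F.obj.map (f ⊗ₘ g) (F.obj.map ((λ_ b).inv ≫ unitDn t ▷ b) s)
    rw [← LinFun.map_comp_apply, ← LinFun.map_comp_apply]
    congr 3
    simp only [MonoidalCategory.tensorHom_def', comp_whiskerRight, Category.assoc]
    rw [← whisker_exchange_assoc]
    simp)

lemma leftUnitHom_mk {a b x : C} (h : a ⊗ b ⟶ x) (t : (dayUnit k C).at a) (s : F.at b) :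
    (leftUnitHom F).hom.app x (mk h t s) =
      F.obj.map ((λ_ b).inv ≫ unitDn t ▷ b ≫ h) s := by
  refine (dayDesc_mk _ _ h _ s).trans ?_
  change F.obj.map h (F.obj.map ((λ_ b).inv ≫ unitDn t ▷ b) s) = _
  rw [← LinFun.map_comp_apply]
  simp

/-- The inverse left unitor. -/
def leftUnitInv (F : LinFun k C) : F ⟶ dayConv (dayUnit k C) F :=
  ObjectProperty.homMk
    { app := fun x => ModuleCat.ofHom
        (mkₗ (dayUnit k C) F (λ_ x).hom (unitMk (𝟙 (𝟙_ C))))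
      naturality := fun x y f => by
        ext s
        change mk (λ_ y).hom (unitMk (𝟙 (𝟙_ C))) (F.obj.map f s) =
          (dayConv (dayUnit k C) F).obj.map f (mk (λ_ x).hom (unitMk (𝟙 (𝟙_ C))) s)
        rw [mk_map_right, dayConv_map]
        simp }

lemma leftUnitInv_apply {x : C} (s : F.at x) :
    (leftUnitInv F).hom.app x s = mk (λ_ x).hom (unitMk (𝟙 (𝟙_ C))) s :=
  rfl

lemma leftUnitHom_inv : leftUnitHom F ≫ leftUnitInv F = 𝟙 _ :=
  dayConv_hom_ext fun a b t s => by
    rw [LinFun.comp_apply, LinFun.id_apply, leftUnitHom_mk, leftUnitInv_apply, mk_map_right]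
    conv_rhs => rw [dayUnit_eq_map t, mk_map_left]
    congr 1
    simp

lemma leftUnitInv_hom : leftUnitInv F ≫ leftUnitHom F = 𝟙 _ :=
  LinFun.hom_ext fun x s => by
    rw [LinFun.comp_apply, LinFun.id_apply, leftUnitInv_apply, leftUnitHom_mk]
    simp

/-- The bilinear maps `F a × C(1, b) → F (a ⊗ b)` defining the right unitor. -/
def rightUnitFam (F : LinFun k C) (a b : C) :
    F.at a →ₗ[k] (dayUnit k C).at b →ₗ[k] F.at (a ⊗ b) :=
  LinearMap.mk₂ k (fun s t => F.obj.map ((ρ_ a).inv ≫ a ◁ unitDn t) s)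
    (fun t s s' => map_add _ _ _)
    (fun r t s => map_smul _ _ _)
    (fun s t t' => by
      rw [unitDn_add, MonoidalPreadditive.whiskerLeft_add, Preadditive.comp_add,
        LinFun.map_add_apply])
    (fun r s t => by
      rw [unitDn_smul, MonoidalLinear.whiskerLeft_smul, Linear.comp_smul,
        LinFun.map_smul_apply])

/-- The right unitor `F * C(1, -) ⟶ F`. -/
def rightUnitHom (F : LinFun k C) : dayConv F (dayUnit k C) ⟶ F :=
  dayDesc (rightUnitFam F) (fun a a' b b' f g s t => by
    change F.obj.map ((ρ_ a').inv ≫ a' ◁ (unitDn t ≫ g)) (F.obj.map f s) =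
      F.obj.map (f ⊗ₘ g) (F.obj.map ((ρ_ a).inv ≫ a ◁ unitDn t) s)
    rw [← LinFun.map_comp_apply, ← LinFun.map_comp_apply]
    congr 3
    simp only [MonoidalCategory.tensorHom_def, MonoidalCategory.whiskerLeft_comp, Category.assoc]
    rw [whisker_exchange_assoc]
    simp)

lemma rightUnitHom_mk {a b x : C} (h : a ⊗ b ⟶ x) (s : F.at a) (t : (dayUnit k C).at b) :
    (rightUnitHom F).hom.app x (mk h s t) =
      F.obj.map ((ρ_ a).inv ≫ a ◁ unitDn t ≫ h) s := by
  refine (dayDesc_mk _ _ h s _).trans ?_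
  change F.obj.map h (F.obj.map ((ρ_ a).inv ≫ a ◁ unitDn t) s) = _
  rw [← LinFun.map_comp_apply]
  simp

/-- The inverse right unitor. -/
def rightUnitInv (F : LinFun k C) : F ⟶ dayConv F (dayUnit k C) :=
  ObjectProperty.homMk
    { app := fun x => ModuleCat.ofHom
        ((mkₗ F (dayUnit k C) (ρ_ x).hom).flip (unitMk (𝟙 (𝟙_ C))))
      naturality := fun x y f => by
        ext s
        change mk (ρ_ y).hom (F.obj.map f s) (unitMk (𝟙 (𝟙_ C))) =
          (dayConv F (dayUnit k C)).obj.map f (mk (ρ_ x).hom s (unitMk (𝟙 (𝟙_ C))))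
        rw [mk_map_left, dayConv_map]
        simp }

lemma rightUnitInv_apply {x : C} (s : F.at x) :
    (rightUnitInv F).hom.app x s =
      mk (ρ_ x).hom s (unitMk (𝟙 (𝟙_ C))) :=
  rfl

lemma rightUnitHom_inv : rightUnitHom F ≫ rightUnitInv F = 𝟙 _ :=
  dayConv_hom_ext fun a b s t => by
    rw [LinFun.comp_apply, LinFun.id_apply, rightUnitHom_mk, rightUnitInv_apply, mk_map_left]
    conv_rhs => rw [dayUnit_eq_map t, mk_map_right]
    congr 1
    simp

lemma rightUnitInv_hom : rightUnitInv F ≫ rightUnitHom F = 𝟙 _ :=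
  LinFun.hom_ext fun x s => by
    rw [LinFun.comp_apply, LinFun.id_apply, rightUnitInv_apply, rightUnitHom_mk]
    simp

lemma dayHom_id : dayHom (𝟙 F) (𝟙 G) = 𝟙 _ :=
  dayConv_hom_ext fun a b s t => by
    rw [dayHom_mk, LinFun.id_apply, LinFun.id_apply, LinFun.id_apply]

lemma dayHom_comp (σ : F ⟶ F') (τ : G ⟶ G') (σ' : F' ⟶ H) (τ' : G' ⟶ K) :
    dayHom σ τ ≫ dayHom σ' τ' = dayHom (σ ≫ σ') (τ ≫ τ') :=
  dayConv_hom_ext fun a b s t => by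
    rw [LinFun.comp_apply, dayHom_mk, dayHom_mk, dayHom_mk, LinFun.comp_apply, LinFun.comp_apply]

lemma assocHom_naturality (σ : F ⟶ F') (τ : G ⟶ G') (υ : H ⟶ H') :
    dayHom (dayHom σ τ) υ ≫ assocHom F' G' H' = assocHom F G H ≫ dayHom σ (dayHom τ υ) :=
  dayConv_hom_ext_left fun a b c s t z => by
    rw [LinFun.comp_apply, LinFun.comp_apply, dayHom_mk, dayHom_mk, assocHom_mk, assocHom_mk,
      dayHom_mk, dayHom_mk]

lemma leftUnitHom_naturality (τ : F ⟶ G) :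
    dayHom (𝟙 (dayUnit k C)) τ ≫ leftUnitHom G = leftUnitHom F ≫ τ :=
  dayConv_hom_ext fun a b t s => by
    rw [LinFun.comp_apply, LinFun.comp_apply, dayHom_mk, LinFun.id_apply, leftUnitHom_mk,
      leftUnitHom_mk, LinFun.naturality_apply]

lemma rightUnitHom_naturality (τ : F ⟶ G) :
    dayHom τ (𝟙 (dayUnit k C)) ≫ rightUnitHom G = rightUnitHom F ≫ τ :=
  dayConv_hom_ext fun a b s t => by
    rw [LinFun.comp_apply, LinFun.comp_apply, dayHom_mk, LinFun.id_apply, rightUnitHom_mk,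
      rightUnitHom_mk, LinFun.naturality_apply]

lemma day_pentagon (F G H K : LinFun k C) :
    dayHom (assocHom F G H) (𝟙 K) ≫ assocHom F (dayConv G H) K ≫ dayHom (𝟙 F) (assocHom G H K) =
      assocHom (dayConv F G) H K ≫ assocHom F G (dayConv H K) :=
  dayConv_hom_ext_left₂ fun a b c d s t z w => by
    simp only [LinFun.comp_apply]
    rw [dayHom_mk, assocHom_mk, assocHom_mk, assocHom_mk, dayHom_mk, assocHom_mk, assocHom_mk,
      LinFun.id_apply, LinFun.id_apply, mk_mk_right]
    congr 1
    simp

lemma day_triangle (F G : LinFun k C) :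
    assocHom F (dayUnit k C) G ≫ dayHom (𝟙 F) (leftUnitHom G) = dayHom (rightUnitHom F) (𝟙 G) :=
  dayConv_hom_ext_left fun a b c s t z => by
    rw [LinFun.comp_apply, assocHom_mk, dayHom_mk, dayHom_mk, leftUnitHom_mk, rightUnitHom_mk,
      mk_map_left, LinFun.id_apply, LinFun.id_apply, mk_map_right]
    congr 1
    simp

end

variable [MonoidalPreadditive C] [MonoidalLinear k C]

instance : MonoidalCategoryStruct (LinFun k C) where
  tensorObj F G := dayConv F G
  tensorHom σ τ := dayHom σ τ
  whiskerLeft F _ _ τ := dayHom (𝟙 F) τ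
  whiskerRight σ G := dayHom σ (𝟙 G)
  tensorUnit := dayUnit k C
  associator F G H := ⟨assocHom F G H, assocInv F G H, assocHom_assocInv, assocInv_assocHom⟩
  leftUnitor F := ⟨leftUnitHom F, leftUnitInv F, leftUnitHom_inv, leftUnitInv_hom⟩
  rightUnitor F := ⟨rightUnitHom F, rightUnitInv F, rightUnitHom_inv, rightUnitInv_hom⟩

/-- The monoidal category `[C, Vect]` with Day convolution as tensor product. -/
instance : MonoidalCategory (LinFun k C) := MonoidalCategory.ofTensorHom
  (id_tensorHom_id := fun _ _ => dayHom_id)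
  (id_tensorHom := fun _ _ _ _ => rfl)
  (tensorHom_id := fun _ _ => rfl)
  (tensorHom_comp_tensorHom := fun σ τ σ' τ' => dayHom_comp σ τ σ' τ')
  (associator_naturality := fun σ τ υ => assocHom_naturality σ τ υ)
  (leftUnitor_naturality := fun τ => leftUnitHom_naturality τ)
  (rightUnitor_naturality := fun τ => rightUnitHom_naturality τ)
  (pentagon := fun F G H K => day_pentagon F G H K)
  (triangle := fun F G => day_triangle F G)

end Monoidal

section LinearStructure

variable {k : Type w} [Field k] {C : Type u} [Category.{v} C] [Preadditive C] [Linear k C]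
  [MonoidalCategory C] [MonoidalPreadditive C] [MonoidalLinear k C]

/-- Day convolution is a biadditive functor. -/
instance : MonoidalPreadditive (LinFun k C) where
  whiskerLeft_zero {F G H} := dayConv_hom_ext fun a b s t =>
    (dayHom_mk (𝟙 F) (0 : G ⟶ H) _ s t).trans (map_zero (mkₗ F H (𝟙 (a ⊗ b)) s))
  zero_whiskerRight {F G H} := dayConv_hom_ext fun a b s t =>
    (dayHom_mk (0 : G ⟶ H) (𝟙 F) _ s t).trans
      (LinearMap.congr_fun (map_zero (mkₗ H F (𝟙 (a ⊗ b)))) t)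
  whiskerLeft_add {F _ H} σ τ := dayConv_hom_ext fun a b s t =>
    (dayHom_mk (𝟙 F) (σ + τ) _ s t).trans
      ((map_add (mkₗ F H (𝟙 (a ⊗ b)) s) _ _).trans
        (congrArg₂ (· + ·) (dayHom_mk (𝟙 F) σ _ s t).symm (dayHom_mk (𝟙 F) τ _ s t).symm))
  add_whiskerRight {F _ H} σ τ := dayConv_hom_ext fun a b s t =>
    (dayHom_mk (σ + τ) (𝟙 F) _ s t).trans
      ((LinearMap.congr_fun (map_add (mkₗ H F (𝟙 (a ⊗ b))) _ _) t).trans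
        (congrArg₂ (· + ·) (dayHom_mk σ (𝟙 F) _ s t).symm (dayHom_mk τ (𝟙 F) _ s t).symm))

/-- Day convolution is a `k`-bilinear functor. -/
instance : MonoidalLinear k (LinFun k C) where
  whiskerLeft_smul F {_ H} r τ := dayConv_hom_ext fun a b s t =>
    (dayHom_mk (𝟙 F) (r • τ) _ s t).trans
      ((map_smul (mkₗ F H (𝟙 (a ⊗ b)) s) r _).trans
        (congrArg (r • ·) (dayHom_mk (𝟙 F) τ _ s t).symm))
  smul_whiskerRight r {_ H} τ F := dayConv_hom_ext fun a b s t =>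
    (dayHom_mk (r • τ) (𝟙 F) _ s t).trans
      ((LinearMap.congr_fun (map_smul (mkₗ H F (𝟙 (a ⊗ b))) r _) t).trans
        (congrArg (r • ·) (dayHom_mk τ (𝟙 F) _ s t).symm))

end LinearStructure

section GrothendieckVerdier

variable {M : Type*} [Category* M] [MonoidalCategory M]

/-- `(M, d)` is a left Grothendieck–Verdier category with left dualising functor `D`: there is an
isomorphism `M(x ⊗ y, d) ≅ M(x, D y)`, natural in `x` and `y`, and `D` is an equivalence.
(By the Yoneda lemma such isomorphisms are linear whenever `M` is a linear monoidal category.) -/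
structure IsLeftGrothendieckVerdier (d : M) (D : Mᵒᵖ ⥤ M) : Prop where
  isEquivalence : D.IsEquivalence
  exists_homEquiv : ∃ e : ∀ x y : M, (x ⊗ y ⟶ d) ≃ (x ⟶ D.obj (op y)),
    (∀ (x x' y : M) (g : x' ⟶ x) (f : x ⊗ y ⟶ d), e x' y (g ▷ y ≫ f) = g ≫ e x y f) ∧
    (∀ (x y y' : M) (g : y' ⟶ y) (f : x ⊗ y ⟶ d), e x y' (x ◁ g ≫ f) = e x y f ≫ D.map g.op)

/-- `(M, d)` is a right Grothendieck–Verdier category with right dualising functor `D`: there is an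
isomorphism `M(x ⊗ y, d) ≅ M(y, D x)`, natural in `x` and `y`, and `D` is an equivalence. -/
structure IsRightGrothendieckVerdier (d : M) (D : Mᵒᵖ ⥤ M) : Prop where
  isEquivalence : D.IsEquivalence
  exists_homEquiv : ∃ e : ∀ x y : M, (x ⊗ y ⟶ d) ≃ (y ⟶ D.obj (op x)),
    (∀ (x y y' : M) (g : y' ⟶ y) (f : x ⊗ y ⟶ d), e x y' (x ◁ g ≫ f) = g ≫ e x y f) ∧
    (∀ (x x' y : M) (g : x' ⟶ x) (f : x ⊗ y ⟶ d), e x' y (g ▷ y ≫ f) = e x y f ≫ D.map g.op)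

/-- The isomorphisms `M(x ⊗ y, d) ≅ M(x, D y)` are determined by the morphisms `D y ⊗ y ⟶ d`. -/
lemma IsLeftGrothendieckVerdier.exists_ev {d : M} {D : Mᵒᵖ ⥤ M}
    (hD : IsLeftGrothendieckVerdier d D) : ∃ ev : ∀ y : M, D.obj (op y) ⊗ y ⟶ d,
      (∀ (x y : M) (p q : x ⟶ D.obj (op y)), p ▷ y ≫ ev y = q ▷ y ≫ ev y → p = q) ∧
      (∀ (y y' : M) (g : y' ⟶ y), D.map g.op ▷ y' ≫ ev y' = D.obj (op y) ◁ g ≫ ev y) := by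
  obtain ⟨e, h₁, h₂⟩ := hD.exists_homEquiv
  have key : ∀ (x y : M) (p : x ⟶ D.obj (op y)), e x y (p ▷ y ≫ (e _ y).symm (𝟙 _)) = p := by
    intro x y p
    rw [h₁, Equiv.apply_symm_apply, Category.comp_id]
  refine ⟨fun y => (e _ y).symm (𝟙 _), fun x y p q hpq => ?_, fun y y' g => ?_⟩
  · rw [← key x y p, ← key x y q, hpq]
  · apply (e _ y').injective
    rw [key, h₂, Equiv.apply_symm_apply, Category.id_comp]

variable [Preadditive M] [MonoidalPreadditive M]

lemma IsLeftGrothendieckVerdier.map_add {d : M} {D : Mᵒᵖ ⥤ M}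
    (hD : IsLeftGrothendieckVerdier d D) {x y : M} (f g : x ⟶ y) :
    D.map (f + g).op = D.map f.op + D.map g.op := by
  obtain ⟨ev, h₁, h₂⟩ := hD.exists_ev
  apply h₁
  simp only [h₂, MonoidalPreadditive.whiskerLeft_add, MonoidalPreadditive.add_whiskerRight,
    Preadditive.add_comp]

lemma IsLeftGrothendieckVerdier.map_smul {k : Type*} [Field k] [Linear k M] [MonoidalLinear k M]
    {d : M} {D : Mᵒᵖ ⥤ M} (hD : IsLeftGrothendieckVerdier d D) {x y : M} (r : k) (f : x ⟶ y) :
    D.map (r • f).op = r • D.map f.op := by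
  obtain ⟨ev, h₁, h₂⟩ := hD.exists_ev
  apply h₁
  simp only [h₂, MonoidalLinear.whiskerLeft_smul, MonoidalLinear.smul_whiskerRight,
    Linear.smul_comp]

end GrothendieckVerdier

section FiniteDimensional

variable (k : Type w) [Field k] (C : Type u) [Category.{v} C] [Preadditive C] [Linear k C]

/-- A `k`-linear category is hom-finite if all its hom spaces are finite-dimensional. -/
class HomFinite : Prop where
  finite_hom : ∀ x y : C, FiniteDimensional k (x ⟶ y)

/-- The property of being pointwise finite-dimensional. -/
def isFinDim : ObjectProperty (LinFun k C) := fun F => ∀ x : C, FiniteDimensional k (F.at x)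

/-- The category `[C, vect]` of `k`-linear functors with finite-dimensional values. (The vector
spaces live in a universe containing `k`, `C` and its hom spaces, so that all coends over `C` exist
there.) -/
abbrev FinFun := (isFinDim k C).FullSubcategory

/-- The coends defining the Day convolution of two finite-dimensional functors are
finite-dimensional. -/
class FiniteDayConvolution [MonoidalCategory C] : Prop where
  finite_dayConv : ∀ F G : LinFun k C, isFinDim k C F → isFinDim k C G →
    isFinDim k C (dayConv F G)

variable {C}

/-- The functor `C(-, d)*` in `[C, vect]`. -/
def dualYoneda [HomFinite k C] (d : C) : FinFun k C where
  obj :=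
    { obj :=
        { obj := fun x => ModuleCat.of k (ULift.{u} (Module.Dual k (x ⟶ d)))
          map := fun {x y} f => ModuleCat.ofHom
            (ULift.moduleEquiv.symm.toLinearMap ∘ₗ (Linear.leftComp k d f).dualMap ∘ₗ
              ULift.moduleEquiv.toLinearMap)
          map_id := fun x => ModuleCat.hom_ext <| LinearMap.ext fun ξ => ULift.ext _ _ <|
            LinearMap.ext fun g => congrArg ξ.down (Category.id_comp g)
          map_comp := fun f f' => ModuleCat.hom_ext <| LinearMap.ext fun ξ => ULift.ext _ _ <|
            LinearMap.ext fun g => congrArg ξ.down (Category.assoc f f' g) }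
      property :=
        ⟨⟨fun {_ _ f f'} => ModuleCat.hom_ext <| LinearMap.ext fun ξ => ULift.ext _ _ <|
            LinearMap.ext fun g => (congrArg ξ.down (Preadditive.add_comp _ _ d f f' g)).trans
              (ξ.down.map_add _ _)⟩,
          ⟨fun f r => ModuleCat.hom_ext <| LinearMap.ext fun ξ => ULift.ext _ _ <|
            LinearMap.ext fun g => (congrArg ξ.down (Linear.smul_comp _ _ d r f g)).trans
              (ξ.down.map_smul _ _)⟩⟩ }
  property x :=
    have := HomFinite.finite_hom (k := k) x d
    Module.Finite.equiv (ULift.moduleEquiv (R := k) (M := Module.Dual k (x ⟶ d))).symm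

variable [MonoidalCategory C] [MonoidalPreadditive C] [MonoidalLinear k C]

/-- Finite-dimensional functors contain the unit and are closed under Day convolution; hence
`FinFun k C` is a full monoidal subcategory of `LinFun k C`. -/
instance [HomFinite k C] [FiniteDayConvolution k C] : (isFinDim k C).IsMonoidal where
  prop_unit x :=
    have := HomFinite.finite_hom (k := k) (𝟙_ C) x
    Module.Finite.equiv (ULift.moduleEquiv (R := k) (M := 𝟙_ C ⟶ x)).symm
  prop_tensor F G hF hG := FiniteDayConvolution.finite_dayConv F G hF hG

variable {k}

/-- The functor `F(D -)*`, for `D` the dualising functor of a left Grothendieck–Verdier category. -/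
def dualPrecomp {d : C} {D : Cᵒᵖ ⥤ C} (hD : IsLeftGrothendieckVerdier d D) (F : FinFun k C) :
    FinFun k C where
  obj :=
    { obj :=
        { obj := fun x => ModuleCat.of k (Module.Dual k (F.obj.at (D.obj (op x))))
          map := fun f => ModuleCat.ofHom (F.obj.obj.map (D.map f.op)).hom.dualMap
          map_id := fun x => by
            rw [op_id, D.map_id, F.obj.obj.map_id]
            rfl
          map_comp := fun f g => by
            rw [op_comp, D.map_comp, F.obj.obj.map_comp]
            rfl }
      property :=
        ⟨⟨fun {_ _ f g} => by
            simp only [hD.map_add, F.obj.obj.map_add]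
            refine ModuleCat.hom_ext (LinearMap.ext fun ξ => LinearMap.ext fun s => ?_)
            exact LinearMap.map_add (ξ : Module.Dual k _) _ _⟩,
          ⟨fun f r => by
            simp only [hD.map_smul, F.obj.obj.map_smul]
            refine ModuleCat.hom_ext (LinearMap.ext fun ξ => LinearMap.ext fun s => ?_)
            exact LinearMap.map_smul (ξ : Module.Dual k _) _ _⟩⟩ }
  property x :=
    have : FiniteDimensional k (F.obj.at (D.obj (op x))) := F.property _
    show FiniteDimensional k (Module.Dual k (F.obj.at (D.obj (op x)))) from inferInstance

/-- The functor `F ↦ F(D -)*` from `[C, vect]ᵒᵖ` to `[C, vect]`. -/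
def dayDualising {d : C} {D : Cᵒᵖ ⥤ C} (hD : IsLeftGrothendieckVerdier d D) :
    (FinFun k C)ᵒᵖ ⥤ FinFun k C where
  obj F := dualPrecomp hD F.unop
  map {F G} τ := ObjectProperty.homMk (ObjectProperty.homMk
    { app := fun x => ModuleCat.ofHom (τ.unop.hom.hom.app (D.obj (op x))).hom.dualMap
      naturality := fun x y f => by
        ext ξ
        refine LinearMap.ext fun s => ?_
        exact congrArg (DFunLike.coe (F := Module.Dual k _) ξ) (LinFun.naturality_apply τ.unop.hom (D.map f.op) s).symm })
  map_id F := rfl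
  map_comp σ τ := rfl

end FiniteDimensional

end DayGV
end

/-! By the universal property of the coend, a morphism from `F * G` to `C(-, d)*` is a family of
bilinear forms on `F a × G b`, one for each `f : a ⊗ b ⟶ d`, compatible with morphisms in `a` and
`b` (`pairing`). The Grothendieck–Verdier structure of `C` makes every such `f` factor uniquely as
`hD.curry f ▷ b ≫ hD.ev b`. By compatibility the form at `f` is then the form at `hD.ev b` with `F
(hD.curry f)` applied to its first argument. So the family amounts to its members on `F (D b) × G
b`, that is, to linear maps `G b → F (D b)*` natural in `b`. This is `dayDualEquiv`, a Yoneda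
argument carried by `whiskerRight_curry_ev` and `map_whiskerRight_ev`.

The dualising functor is precomposition with `D` followed by the pointwise dual. Precomposition with
an equivalence is fully faithful, and on finite-dimensional spaces so is the dual, because `V ≅
V**`; this gives `dayDualising_full` and `dayDualising_faithful`. A preimage of `G` is `G (D⁻¹ -)*`,
again by the double dual (`dualPrecompDualPrecompInv`). -/

noncomputable section

namespace DayGV

/-! ### Currying and evaluation in a left Grothendieck–Verdier category. -/

section Curry

variable {M : Type*} [Category* M] [MonoidalCategory M] {d : M} {D : Mᵒᵖ ⥤ M}

/-- The evaluation `D y ⊗ y ⟶ d` of a left Grothendieck–Verdier category. -/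
def IsLeftGrothendieckVerdier.ev (hD : IsLeftGrothendieckVerdier d D) (y : M) :
    D.obj (op y) ⊗ y ⟶ d :=
  (hD.exists_homEquiv.choose _ y).symm (𝟙 _)

/-- The morphism `x ⟶ D y` corresponding to `x ⊗ y ⟶ d`. -/
def IsLeftGrothendieckVerdier.curry (hD : IsLeftGrothendieckVerdier d D) {x y : M}
    (f : x ⊗ y ⟶ d) : x ⟶ D.obj (op y) :=
  hD.exists_homEquiv.choose x y f

/-- Yoneda: naturality in the first variable pulls `p` out of the bijection, and the evaluation
corresponds to the identity. -/
lemma IsLeftGrothendieckVerdier.curry_whiskerRight_ev (hD : IsLeftGrothendieckVerdier d D)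
    {x y : M} (p : x ⟶ D.obj (op y)) : hD.curry (p ▷ y ≫ hD.ev y) = p := by
  rw [curry, hD.exists_homEquiv.choose_spec.1, ev, Equiv.apply_symm_apply, Category.comp_id]

lemma IsLeftGrothendieckVerdier.curry_ev (hD : IsLeftGrothendieckVerdier d D) (y : M) :
    hD.curry (hD.ev y) = 𝟙 _ := by
  rw [curry, ev, Equiv.apply_symm_apply]

lemma IsLeftGrothendieckVerdier.curry_injective (hD : IsLeftGrothendieckVerdier d D)
    {x y : M} {f g : x ⊗ y ⟶ d} (h : hD.curry f = hD.curry g) : f = g :=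
  (hD.exists_homEquiv.choose x y).injective h

/-- The universal property of `ev`: this factorisation is what reduces a pairing at an arbitrary `f`
to the pairing at an evaluation. -/
lemma IsLeftGrothendieckVerdier.whiskerRight_curry_ev (hD : IsLeftGrothendieckVerdier d D)
    {x y : M} (f : x ⊗ y ⟶ d) : hD.curry f ▷ y ≫ hD.ev y = f :=
  hD.curry_injective (hD.curry_whiskerRight_ev _)

lemma IsLeftGrothendieckVerdier.curry_whiskerRight (hD : IsLeftGrothendieckVerdier d D)
    {x x' y : M} (g : x' ⟶ x) (f : x ⊗ y ⟶ d) : hD.curry (g ▷ y ≫ f) = g ≫ hD.curry f :=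
  hD.exists_homEquiv.choose_spec.1 x x' y g f

lemma IsLeftGrothendieckVerdier.curry_whiskerLeft (hD : IsLeftGrothendieckVerdier d D)
    {x y y' : M} (g : y' ⟶ y) (f : x ⊗ y ⟶ d) :
    hD.curry (x ◁ g ≫ f) = hD.curry f ≫ D.map g.op :=
  hD.exists_homEquiv.choose_spec.2 x y y' g f

/-- Dinaturality of the evaluation, since both sides curry to `D.map g.op`. It is the source of the
naturality of `toDual`. -/
lemma IsLeftGrothendieckVerdier.map_whiskerRight_ev (hD : IsLeftGrothendieckVerdier d D)
    {y y' : M} (g : y' ⟶ y) :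
    D.map g.op ▷ y' ≫ hD.ev y' = D.obj (op y) ◁ g ≫ hD.ev y :=
  hD.curry_injective (by
    rw [hD.curry_whiskerRight_ev, hD.curry_whiskerLeft, hD.curry_ev, Category.id_comp])

variable [Preadditive M] [MonoidalPreadditive M]

/-- The structure only supplies bijections of sets, but the inverse `p ↦ p ▷ y ≫ hD.ev y` is visibly
additive, hence so is `curry`; scalars are treated likewise in `curry_smul`. -/
lemma IsLeftGrothendieckVerdier.curry_add (hD : IsLeftGrothendieckVerdier d D) {x y : M}
    (f g : x ⊗ y ⟶ d) : hD.curry (f + g) = hD.curry f + hD.curry g := by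
  rw [← hD.curry_whiskerRight_ev (hD.curry f + hD.curry g),
    MonoidalPreadditive.add_whiskerRight, Preadditive.add_comp, hD.whiskerRight_curry_ev,
    hD.whiskerRight_curry_ev]

lemma IsLeftGrothendieckVerdier.curry_smul {k : Type*} [Field k] [Linear k M]
    [MonoidalLinear k M] (hD : IsLeftGrothendieckVerdier d D) {x y : M} (r : k)
    (f : x ⊗ y ⟶ d) : hD.curry (r • f) = r • hD.curry f := by
  rw [← hD.curry_whiskerRight_ev (r • hD.curry f), MonoidalLinear.smul_whiskerRight,
    Linear.smul_comp, hD.whiskerRight_curry_ev]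

end Curry

/-! ### The bijection between morphisms `F * G ⟶ C(-, d)*` and `G ⟶ F (D -)*`. -/

section HomEquiv

variable {k : Type w} [Field k] {C : Type u} [Category.{v} C] [Preadditive C] [Linear k C]
  [MonoidalCategory C] [MonoidalPreadditive C] [MonoidalLinear k C]
  {d : C} {D : Cᵒᵖ ⥤ C} {F F' G G' : FinFun k C}

section

variable (hD : IsLeftGrothendieckVerdier d D)

/-- The elements of `F(D x)*` as linear forms on `F(D x)`. -/
def dualForm (F : FinFun k C) (x : C) :
    (dualPrecomp hD F).obj.at x ≃ₗ[k] Module.Dual k (F.obj.at (D.obj (op x))) :=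
  LinearEquiv.refl k _

lemma dualForm_map {x y : C} (g : x ⟶ y) (ξ : (dualPrecomp hD F).obj.at x)
    (s : F.obj.at (D.obj (op y))) :
    dualForm hD F y ((dualPrecomp hD F).obj.obj.map g ξ) s =
      dualForm hD F x ξ (F.obj.obj.map (D.map g.op) s) := rfl

lemma dualPrecomp_hom_ext {τ τ' : G ⟶ dualPrecomp hD F}
    (h : ∀ (b : C) (t : G.obj.at b) (s : F.obj.at (D.obj (op b))),
      dualForm hD F b (τ.hom.hom.app b t) s = dualForm hD F b (τ'.hom.hom.app b t) s) :
    τ = τ' :=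
  ObjectProperty.hom_ext _ (LinFun.hom_ext fun b t => LinearMap.ext (h b t))

end

variable [HomFinite k C]

/-- Evaluation of an element of `C(x, d)*` at a morphism `x ⟶ d`. -/
def evalDual {d x : C} (f : x ⟶ d) : (dualYoneda k d).obj.at x →ₗ[k] k :=
  Module.Dual.eval k (x ⟶ d) f ∘ₗ ULift.moduleEquiv.toLinearMap

lemma evalDual_map {x y : C} (g : x ⟶ y) (f : y ⟶ d) (ξ : (dualYoneda k d).obj.at x) :
    evalDual f ((dualYoneda k d).obj.obj.map g ξ) = evalDual (g ≫ f) ξ := rfl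

lemma evalDual_ext {x : C} {ξ η : (dualYoneda k d).obj.at x}
    (h : ∀ f : x ⟶ d, evalDual f ξ = evalDual f η) : ξ = η :=
  ULift.ext _ _ (LinearMap.ext h)

variable [FiniteDayConvolution k C]

/-- The bilinear form `F a × G b → k` defined by a morphism `F * G ⟶ C(-, d)*` and a morphism
`a ⊗ b ⟶ d`. -/
def pairing (σ : F ⊗ G ⟶ dualYoneda k d) {a b : C} (f : a ⊗ b ⟶ d) :
    F.obj.at a →ₗ[k] G.obj.at b →ₗ[k] k :=
  (mkₗ F.obj G.obj (𝟙 (a ⊗ b))).compr₂ (evalDual f ∘ₗ (σ.hom.hom.app (a ⊗ b)).hom)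

lemma pairing_apply (σ : F ⊗ G ⟶ dualYoneda k d) {a b : C} (f : a ⊗ b ⟶ d)
    (s : F.obj.at a) (t : G.obj.at b) :
    pairing σ f s t = evalDual f (σ.hom.hom.app (a ⊗ b) (mk (𝟙 (a ⊗ b)) s t)) := rfl

/-- Naturality of `σ` along `g`, read through the fact that `C(-, d)*` acts by precomposition on the
argument of a linear form. -/
lemma pairing_comp (σ : F ⊗ G ⟶ dualYoneda k d) {a b y : C} (g : a ⊗ b ⟶ y) (f : y ⟶ d)
    (s : F.obj.at a) (t : G.obj.at b) :
    pairing σ (g ≫ f) s t = evalDual f (σ.hom.hom.app y (mk g s t)) := by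
  rw [pairing_apply, ← evalDual_map, dayMk_eq_map g]
  exact congrArg (evalDual f) (LinFun.naturality_apply σ.hom g _).symm

/-- The coend relation moves `g` from the vector into the morphism slot, from where `pairing_comp`
moves it into `f`. -/
lemma pairing_map_left (σ : F ⊗ G ⟶ dualYoneda k d) {a a' b : C} (g : a ⟶ a')
    (f : a' ⊗ b ⟶ d) (s : F.obj.at a) (t : G.obj.at b) :
    pairing σ f (F.obj.obj.map g s) t = pairing σ (g ▷ b ≫ f) s t := by
  rw [pairing_comp, pairing_apply, mk_map_left, Category.comp_id]

lemma pairing_map_right (σ : F ⊗ G ⟶ dualYoneda k d) {a b b' : C} (g : b ⟶ b')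
    (f : a ⊗ b' ⟶ d) (s : F.obj.at a) (t : G.obj.at b) :
    pairing σ f s (G.obj.obj.map g t) = pairing σ (a ◁ g ≫ f) s t := by
  rw [pairing_comp, pairing_apply, mk_map_right, Category.comp_id]

lemma pairing_whiskerRight (σ : F ⊗ G ⟶ dualYoneda k d) (τ : F' ⟶ F) {a b : C}
    (f : a ⊗ b ⟶ d) (s : F'.obj.at a) (t : G.obj.at b) :
    pairing (τ ▷ G ≫ σ) f s t = pairing σ f (τ.hom.hom.app a s) t :=
  congrArg (fun z => evalDual f (σ.hom.hom.app (a ⊗ b) z))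
    (dayHom_mk τ.hom (𝟙 G.obj) (𝟙 (a ⊗ b)) s t)

lemma pairing_whiskerLeft (σ : F ⊗ G ⟶ dualYoneda k d) (τ : G' ⟶ G) {a b : C}
    (f : a ⊗ b ⟶ d) (s : F.obj.at a) (t : G'.obj.at b) :
    pairing (F ◁ τ ≫ σ) f s t = pairing σ f s (τ.hom.hom.app b t) :=
  congrArg (fun z => evalDual f (σ.hom.hom.app (a ⊗ b) z))
    (dayHom_mk (𝟙 F.obj) τ.hom (𝟙 (a ⊗ b)) s t)

/-- The classes with identity morphism generate the Day convolution under its functorial action, and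
an element of `C(a ⊗ b, d)*` is determined by its values. -/
lemma pairing_ext {σ σ' : F ⊗ G ⟶ dualYoneda k d}
    (h : ∀ (a b : C) (f : a ⊗ b ⟶ d) (s : F.obj.at a) (t : G.obj.at b),
      pairing σ f s t = pairing σ' f s t) : σ = σ' :=
  ObjectProperty.hom_ext _ (dayConv_hom_ext fun a b s t => evalDual_ext fun f => h a b f s t)

variable (hD : IsLeftGrothendieckVerdier d D)

/-- The morphism `G ⟶ F(D -)*` corresponding to `F * G ⟶ C(-, d)*`. -/
def toDual (σ : F ⊗ G ⟶ dualYoneda k d) : G ⟶ dualPrecomp hD F :=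
  ObjectProperty.homMk (ObjectProperty.homMk
    { app := fun b => ModuleCat.ofHom (pairing σ (hD.ev b)).flip
      naturality := fun b b' g => by
        ext t
        refine LinearMap.ext fun s => ?_
        change pairing σ (hD.ev b') s (G.obj.obj.map g t) =
          pairing σ (hD.ev b) (F.obj.obj.map (D.map g.op) s) t
        -- Both sides become pairings of the same `s` and `t`, at two morphisms that agree by
        -- dinaturality of the evaluation.
        rw [pairing_map_left, pairing_map_right, hD.map_whiskerRight_ev] })

lemma toDual_apply (σ : F ⊗ G ⟶ dualYoneda k d) {b : C} (t : G.obj.at b)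
    (s : F.obj.at (D.obj (op b))) :
    dualForm hD F b ((toDual hD σ).hom.hom.app b t) s = pairing σ (hD.ev b) s t := rfl

/-- The bilinear maps `F a × G b → C(a ⊗ b, d)*` corresponding to `G ⟶ F(D -)*`. -/
def ofDualFam (τ : G ⟶ dualPrecomp hD F) (a b : C) :
    F.obj.at a →ₗ[k] G.obj.at b →ₗ[k] (dualYoneda k d).obj.at (a ⊗ b) :=
  LinearMap.mk₂ k (fun s t => ULift.up
    -- The formula is forced: since `f = hD.curry f ▷ b ≫ hD.ev b`, the form at `f` must be the form
    -- at the evaluation after transporting `s` along `hD.curry f`.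
    { toFun := fun f => dualForm hD F b (τ.hom.hom.app b t) (F.obj.obj.map (hD.curry f) s)
      map_add' := fun f g => by rw [hD.curry_add, LinFun.map_add_apply, map_add]
      map_smul' := fun r f => by
        rw [hD.curry_smul, LinFun.map_smul_apply, map_smul, RingHom.id_apply] })
    (fun s s' t => ULift.ext _ _ <| LinearMap.ext fun f => by
      simp only [LinearMap.coe_mk, AddHom.coe_mk, map_add]; rfl)
    (fun r s t => ULift.ext _ _ <| LinearMap.ext fun f => by
      simp only [LinearMap.coe_mk, AddHom.coe_mk, map_smul]; rfl)
    (fun s t t' => ULift.ext _ _ <| LinearMap.ext fun f => by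
      simp only [LinearMap.coe_mk, AddHom.coe_mk, map_add]; rfl)
    (fun r s t => ULift.ext _ _ <| LinearMap.ext fun f => by
      simp only [LinearMap.coe_mk, AddHom.coe_mk, map_smul]; rfl)

lemma evalDual_ofDualFam (τ : G ⟶ dualPrecomp hD F) {a b : C} (s : F.obj.at a)
    (t : G.obj.at b) (f : a ⊗ b ⟶ d) :
    evalDual f (ofDualFam hD τ a b s t) =
      dualForm hD F b (τ.hom.hom.app b t) (F.obj.obj.map (hD.curry f) s) := rfl

/-- The morphism `F * G ⟶ C(-, d)*` corresponding to `G ⟶ F(D -)*`. -/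
def ofDual (τ : G ⟶ dualPrecomp hD F) : F ⊗ G ⟶ dualYoneda k d :=
  ObjectProperty.homMk (dayDesc (ofDualFam hD τ) fun a a' b b' f g s t =>
    evalDual_ext fun h => by
      -- Currying `(f ⊗ₘ g) ≫ h` gives `f ≫ hD.curry h ≫ D.map g.op`; the last factor matches the
      -- action of `g` on `F (D -)*`, brought in by naturality of `τ`.
      rw [evalDual_map, evalDual_ofDualFam, evalDual_ofDualFam, MonoidalCategory.tensorHom_def, Category.assoc,
        hD.curry_whiskerRight, hD.curry_whiskerLeft, LinFun.naturality_apply,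
        dualForm_map, ← LinFun.map_comp_apply, ← LinFun.map_comp_apply])

lemma pairing_ofDual (τ : G ⟶ dualPrecomp hD F) {a b : C} (f : a ⊗ b ⟶ d) (s : F.obj.at a)
    (t : G.obj.at b) : pairing (ofDual hD τ) f s t =
      dualForm hD F b (τ.hom.hom.app b t) (F.obj.obj.map (hD.curry f) s) := by
  rw [pairing_apply, ← evalDual_ofDualFam]
  refine (congrArg (evalDual f) (dayDesc_mk _ _ (𝟙 (a ⊗ b)) s t)).trans ?_
  rw [LinFun.map_id_apply]

/-- Morphisms `F * G ⟶ C(-, d)*` are the same as morphisms `G ⟶ F(D -)*`. -/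
def dayDualEquiv (F G : FinFun k C) :
    (F ⊗ G ⟶ dualYoneda k d) ≃ (G ⟶ dualPrecomp hD F) where
  toFun := toDual hD
  invFun := ofDual hD
  left_inv σ := pairing_ext fun a b f s t => by
    rw [pairing_ofDual, toDual_apply, pairing_map_left, hD.whiskerRight_curry_ev]
  right_inv τ := dualPrecomp_hom_ext hD fun b t s => by
    rw [toDual_apply, pairing_ofDual, hD.curry_ev, LinFun.map_id_apply]

end HomEquiv

/-! ### The dualising functor is an equivalence: transposition for full faithfulness, double duals
for essential surjectivity. -/

section Equivalence

variable {k : Type w} [Field k] {C : Type u} [Category.{v} C] [Preadditive C] [Linear k C]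
  [MonoidalCategory C] [MonoidalPreadditive C] [MonoidalLinear k C]
  {d : C} {D : Cᵒᵖ ⥤ C} (hD : IsLeftGrothendieckVerdier d D)

variable {F G : FinFun k C}

lemma dayDualising_map_apply {F G : (FinFun k C)ᵒᵖ} (τ : F ⟶ G) {x : C}
    (ξ : (dualPrecomp hD F.unop).obj.at x) (s : G.unop.obj.at (D.obj (op x))) :
    dualForm hD G.unop x (((dayDualising hD).map τ).hom.hom.app x ξ) s =
      dualForm hD F.unop x ξ (τ.unop.hom.hom.app (D.obj (op x)) s) := rfl

instance (F : FinFun k C) (x : C) : FiniteDimensional k (F.obj.at x) := F.property x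

lemma dual_separates {V : Type*} [AddCommGroup V] [Module k V] {v w : V}
    (h : ∀ ξ : Module.Dual k V, ξ v = ξ w) : v = w :=
  Module.eval_apply_injective k (LinearMap.ext h)

/-- The linear map `G(D x) → F(D x)` whose dual is the component at `x` of a morphism
`F(D -)* ⟶ G(D -)*`. -/
def transposeApp (σ : dualPrecomp hD F ⟶ dualPrecomp hD G) (x : C) :
    G.obj.at (D.obj (op x)) →ₗ[k] F.obj.at (D.obj (op x)) :=
  (Module.evalEquiv k _).symm.toLinearMap ∘ₗ
    ((dualForm hD G x).toLinearMap ∘ₗ (σ.hom.hom.app x).hom ∘ₗ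
      (dualForm hD F x).symm.toLinearMap).dualMap ∘ₗ Module.Dual.eval k _

/-- The defining property of the transpose. Linear forms separate points, so identities involving
`transposeApp` can be checked through this one. -/
lemma dualForm_transposeApp (σ : dualPrecomp hD F ⟶ dualPrecomp hD G) (x : C)
    (ξ : (dualPrecomp hD F).obj.at x) (s : G.obj.at (D.obj (op x))) :
    dualForm hD F x ξ (transposeApp hD σ x s) = dualForm hD G x (σ.hom.hom.app x ξ) s :=
  Module.apply_evalEquiv_symm_apply k _ _ _

/-- The natural transformation `G ∘ D ⟶ F ∘ D` whose dual is a morphism `F(D -)* ⟶ G(D -)*`. -/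
def transposeTrans (σ : dualPrecomp hD F ⟶ dualPrecomp hD G) :
    D ⋙ G.obj.obj ⟶ D ⋙ F.obj.obj where
  app x := ModuleCat.ofHom (transposeApp hD σ x.unop)
  naturality x y f := by
    ext s
    -- Tested against a linear form `ξ`, the naturality square turns into the one for `σ`.
    refine dual_separates (k := k) fun ξ => ?_
    change dualForm hD F _ ((dualForm hD F y.unop).symm ξ) (transposeApp hD σ y.unop
        (G.obj.obj.map (D.map f.unop.op) s)) =
      dualForm hD F _ ((dualForm hD F y.unop).symm ξ) (F.obj.obj.map (D.map f.unop.op)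
        (transposeApp hD σ x.unop s))
    rw [dualForm_transposeApp, ← dualForm_map, ← dualForm_map, dualForm_transposeApp,
      LinFun.naturality_apply]

lemma dayDualising_full : (dayDualising (k := k) hD).Full where
  map_surjective {F G} σ := by
    have := hD.isEquivalence
    -- The inverse of `congrLeft` is precomposition with `D`; being full, it lifts the transpose of
    -- `σ` from `D ⋙ G ⟶ D ⋙ F` to `G ⟶ F`.
    let e := (D.asEquivalence.congrLeft (E := ModuleCat.{max u v w} k)).inverse
    obtain ⟨τ, hτ⟩ := e.map_surjective (transposeTrans hD (F := F.unop) (G := G.unop) σ)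
    refine ⟨Quiver.Hom.op (ObjectProperty.homMk (ObjectProperty.homMk τ)),
      dualPrecomp_hom_ext hD fun x ξ s => ?_⟩
    exact (congrArg (fun ρ : D ⋙ G.unop.obj.obj ⟶ D ⋙ F.unop.obj.obj =>
      dualForm hD F.unop x ξ (NatTrans.app ρ (op x) s)) hτ).trans
      (dualForm_transposeApp hD σ x ξ s)

lemma dayDualising_faithful : (dayDualising (k := k) hD).Faithful where
  map_injective {F G} τ τ' h := by
    have := hD.isEquivalence
    let e := (D.asEquivalence.congrLeft (E := ModuleCat.{max u v w} k)).inverse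
    apply Quiver.Hom.unop_inj
    apply ObjectProperty.hom_ext
    apply ObjectProperty.hom_ext
    apply e.map_injective
    ext x s
    -- It suffices to compare after composing with every `ξ`, and these composites are the values of
    -- the dualised morphisms.
    refine dual_separates (k := k) fun ξ => ?_
    have key := dayDualising_map_apply hD τ ((dualForm hD F.unop x.unop).symm ξ) s
    rw [h] at key
    exact key.symm.trans (dayDualising_map_apply hD τ' ((dualForm hD F.unop x.unop).symm ξ) s)

/-- The functor `G(D⁻¹ -)*`. -/
def dualPrecompInv (E : Cᵒᵖ ≌ C) (hE : IsLeftGrothendieckVerdier d E.functor) (G : FinFun k C) :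
    FinFun k C where
  obj :=
    { obj :=
        { obj := fun y => ModuleCat.of k (Module.Dual k (G.obj.at (E.inverse.obj y).unop))
          map := fun f => ModuleCat.ofHom (G.obj.obj.map (E.inverse.map f).unop).hom.dualMap
          map_id := fun y => by
            rw [E.inverse.map_id, unop_id, G.obj.obj.map_id]
            rfl
          map_comp := fun f g => by
            rw [E.inverse.map_comp, unop_comp, G.obj.obj.map_comp]
            rfl }
      property :=
        ⟨⟨fun {x y f g} => by
            -- Additivity of the inverse is inherited from that of `E.functor`, which is faithful
            -- and additive by `hE.map_add`.
            have h : E.inverse.map (f + g) =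
                ((E.inverse.map f).unop + (E.inverse.map g).unop).op :=
              E.functor.map_injective (by
                rw [hE.map_add]
                simp [E.fun_inv_map])
            simp only [h, Quiver.Hom.unop_op, G.obj.obj.map_add]
            refine ModuleCat.hom_ext (LinearMap.ext fun ξ => LinearMap.ext fun s => ?_)
            exact LinearMap.map_add (ξ : Module.Dual k _) _ _⟩,
          ⟨fun {x y} f r => by
            have h : E.inverse.map (r • f) = (r • (E.inverse.map f).unop).op :=
              E.functor.map_injective (by
                rw [hE.map_smul]
                simp [E.fun_inv_map])
            simp only [h, Quiver.Hom.unop_op, G.obj.obj.map_smul]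
            refine ModuleCat.hom_ext (LinearMap.ext fun ξ => LinearMap.ext fun s => ?_)
            exact LinearMap.map_smul (ξ : Module.Dual k _) _ _⟩⟩ }
  property y :=
    show FiniteDimensional k (Module.Dual k (G.obj.at (E.inverse.obj y).unop)) from inferInstance

/-- The double dual identifies `G` with the dual of `G(D⁻¹ -)*`. -/
def dualPrecompDualPrecompInv (E : Cᵒᵖ ≌ C) (hE : IsLeftGrothendieckVerdier d E.functor)
    (G : FinFun k C) : G ≅ dualPrecomp hE (dualPrecompInv E hE G) :=
  ObjectProperty.isoMk _ <| ObjectProperty.isoMk _ <| NatIso.ofComponents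
    -- The unit lives in `Cᵒᵖ`, so `unop` reverses it and `symm` restores the direction `x ⟶ D⁻¹ (D
    -- x)` in `C`.
    (fun x => G.obj.obj.mapIso (E.unitIso.app (op x)).unop.symm ≪≫
      (Module.evalEquiv k (G.obj.at (E.inverse.obj (E.functor.obj (op x))).unop)).toModuleIso)
    (fun {x y} f => by
      ext s
      refine LinearMap.ext fun
        (ξ : Module.Dual k (G.obj.at (E.inverse.obj (E.functor.obj (op y))).unop)) => ?_
      change ξ (G.obj.obj.map (E.unitIso.inv.app (op y)).unop (G.obj.obj.map f s)) =
        ξ (G.obj.obj.map (E.inverse.map (E.functor.map f.op)).unop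
          (G.obj.obj.map (E.unitIso.inv.app (op x)).unop s))
      rw [← LinFun.map_comp_apply, ← LinFun.map_comp_apply]
      exact congrArg (fun g => ξ (G.obj.obj.map g s))
        (congrArg Quiver.Hom.unop (E.unitIso.inv.naturality f.op)).symm)

lemma dayDualising_isEquivalence : (dayDualising (k := k) hD).IsEquivalence where
  full := dayDualising_full hD
  faithful := dayDualising_faithful hD
  essSurj :=
    ⟨fun G =>
      have := hD.isEquivalence
      ⟨op (dualPrecompInv D.asEquivalence hD G),
        ⟨(dualPrecompDualPrecompInv D.asEquivalence hD G).symm⟩⟩⟩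

end Equivalence
end DayGV

end

theorem proposition3p27 {k : Type w} [Field k] {C : Type u} [Category.{v} C] [Preadditive C]
    [Linear k C] [MonoidalCategory C] [MonoidalPreadditive C] [MonoidalLinear k C]
    [DayGV.HomFinite k C] [DayGV.FiniteDayConvolution k C]
    (d : C) (D : Cᵒᵖ ⥤ C) (hD : DayGV.IsLeftGrothendieckVerdier d D) :
    DayGV.IsRightGrothendieckVerdier (DayGV.dualYoneda k d : DayGV.FinFun k C)
      (DayGV.dayDualising hD) where
  isEquivalence := DayGV.dayDualising_isEquivalence hD
  exists_homEquiv := ⟨fun F G => DayGV.dayDualEquiv hD F G,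
    -- Naturality in either variable can be read off the pairing at `hD.ev b`: whiskering with `τ`
    -- merely applies `τ` to the corresponding argument.
    fun _ _ _ τ σ => DayGV.dualPrecomp_hom_ext hD fun b t s =>
      DayGV.pairing_whiskerLeft σ τ (hD.ev b) s t,
    fun _ _ _ τ σ => DayGV.dualPrecomp_hom_ext hD fun b t s =>
      DayGV.pairing_whiskerRight σ τ (hD.ev b) s t⟩
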